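/- A quadratic Lie algebra is a pair $(\mathfrak g,B)$ where $\mathfrak g$ is a Lie algebra and $B$ is a non-degenerate symmetric bilinear form on $\mathfrak g$ with $B([x,y],z)=B(x,[y,z])$ for all $x,y,z\in\mathfrak g$. A symplectic structure on $\mathfrak g$ is a non-degenerate skew-symmetric bilinear form $\omega$ on $\mathfrak g$ with $\omega([x,y],z)+\omega([y,z],x)+\omega([z,x],y)=0$ for all $x,y,z\in\mathfrak g$. For a Lie algebra $\mathfrak a$, the trivial $T^*$-extension $T^*_0\mathfrak a$ is the vector space $\mathfrak a\oplus\mathfrak a^*$ with the bracket $$[x+f,\,y+g]=[x,y]_{\mathfrak a}+f\circ\mathrm{ad}(y)-g\circ\mathrm{ad}(x)\qquad(x,y\in\mathfrak a,\ f,g\in\mathfrak a^*),$$ equipped with the invariant form $B_0(x+f,y+g)=f(y)+g(x)$. Two quadratic Lie algebras are isometrically isomorphic if there is a Lie algebra isomorphism between them that carries one form to the other. Over $\mathbb C$, let $\mathcal L_2$ be the Heisenberg algebra, with basis $x_1,x_2,x_3$ and only non-trivial bracket $[x_1,x_2]=x_3$, and let $\mathcal L_3$ be the filiform algebra, with basis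 $x_1,x_2,x_3,x_4$ and only non-trivial brackets $[x_1,x_2]=x_3$ and $[x_1,x_3]=x_4$; $\mathbb C^n$ denotes the $n$-dimensional abelian Lie algebra. **Theorem.** Let $(\mathfrak g,B)$ be a non-zero complex quadratic Lie algebra with $\dim\mathfrak g\le 8$ which admits a symplectic structure. Then $(\mathfrak g,B)$ is isometrically isomorphic to $(T^*_0\mathfrak a,B_0)$, where $\mathfrak a$ is one of the seven Lie algebras $\mathbb C$, $\mathbb C^2$, $\mathbb C^3$, $\mathbb C^4$, $\mathcal L_2$, $\mathcal L_2\oplus\mathbb C$ (direct sum of Lie algebras), $\mathcal L_3$. -/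

import Mathlib

/-- `B` is an invariant scalar product on the Lie algebra `L`, i.e. `(L, B)` is a quadratic Lie
algebra. -/
structure IsInvariantScalarProduct {K L : Type*} [Field K] [LieRing L] [LieAlgebra K L]
    (B : LinearMap.BilinForm K L) : Prop where
  symm : ∀ x y, B x y = B y x
  nondegenerate : B.Nondegenerate
  invariant : ∀ x y z, B ⁅x, y⁆ z = B x ⁅y, z⁆

/-- `ω` is a symplectic structure on the Lie algebra `L`: a non-degenerate skew-symmetric scalar
2-cocycle. -/
structure IsSymplecticStructure {K L : Type*} [Field K] [LieRing L] [LieAlgebra K L]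
    (ω : LinearMap.BilinForm K L) : Prop where
  skew : ∀ x y, ω x y = -ω y x
  nondegenerate : ω.Nondegenerate
  cocycle : ∀ x y z, ω ⁅x, y⁆ z + ω ⁅y, z⁆ x + ω ⁅z, x⁆ y = 0

/-- Two Lie algebras with bilinear forms are isometrically isomorphic. -/
def IsometricallyIsomorphic {K L L' : Type*} [Field K] [LieRing L] [LieAlgebra K L]
    [LieRing L'] [LieAlgebra K L'] (B : LinearMap.BilinForm K L)
    (B' : LinearMap.BilinForm K L') : Prop :=
  ∃ φ : L ≃ₗ⁅K⁆ L', ∀ x y, B' (φ x) (φ y) = B x y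

/-- The trivial `T*`-extension `T*₀ 𝔞` of a Lie algebra `𝔞`; the underlying vector space is
`𝔞 ⊕ 𝔞*`, and `⟨x, f⟩` stands for `x + f`. -/
@[ext]
structure TrivialTStar (K A : Type*) [Field K] [LieRing A] [LieAlgebra K A] where
  vec : A
  covec : Module.Dual K A

namespace TrivialTStar

variable {K A : Type*} [Field K] [LieRing A] [LieAlgebra K A]

/-- The identification of the underlying vector space with `𝔞 × 𝔞*`. -/
def toProd : TrivialTStar K A ≃ A × Module.Dual K A where
  toFun u := (u.vec, u.covec)
  invFun p := ⟨p.1, p.2⟩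
  left_inv _ := rfl
  right_inv _ := rfl

instance : AddCommGroup (TrivialTStar K A) := toProd.addCommGroup

instance : Module K (TrivialTStar K A) := toProd.module K

/-- The bracket `[x + f, y + g] = [x, y] + f ∘ ad y - g ∘ ad x`. -/
instance : Bracket (TrivialTStar K A) (TrivialTStar K A) where
  bracket u v :=
    ⟨⁅u.vec, v.vec⁆, u.covec ∘ₗ LieAlgebra.ad K A v.vec - v.covec ∘ₗ LieAlgebra.ad K A u.vec⟩

@[simp]
theorem zero_vec : (0 : TrivialTStar K A).vec = 0 := rfl

@[simp]
theorem zero_covec : (0 : TrivialTStar K A).covec = 0 := rfl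

@[simp]
theorem add_vec (u v : TrivialTStar K A) : (u + v).vec = u.vec + v.vec := rfl

@[simp]
theorem add_covec (u v : TrivialTStar K A) : (u + v).covec = u.covec + v.covec := rfl

@[simp]
theorem smul_vec (t : K) (u : TrivialTStar K A) : (t • u).vec = t • u.vec := rfl

@[simp]
theorem smul_covec (t : K) (u : TrivialTStar K A) : (t • u).covec = t • u.covec := rfl

@[simp]
theorem lie_vec (u v : TrivialTStar K A) : ⁅u, v⁆.vec = ⁅u.vec, v.vec⁆ := rfl

@[simp]
theorem lie_covec (u v : TrivialTStar K A) : ⁅u, v⁆.covec =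
    u.covec ∘ₗ LieAlgebra.ad K A v.vec - v.covec ∘ₗ LieAlgebra.ad K A u.vec := rfl

instance : LieRing (TrivialTStar K A) where
  add_lie u v w := by ext <;> simp; ring
  lie_add u v w := by ext <;> simp; ring
  lie_self u := by ext <;> simp
  leibniz_lie u v w := by ext <;> simp; ring

instance : LieAlgebra K (TrivialTStar K A) where
  lie_smul t u v := by ext <;> simp; ring

variable (K A)

/-- The canonical form `B(x + f, y + g) = f(y) + g(x)` on `T*₀ 𝔞`. -/
def form : LinearMap.BilinForm K (TrivialTStar K A) :=
  LinearMap.mk₂ K (fun u v => u.covec v.vec + v.covec u.vec)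
    (fun u v w => by simp; ring) (fun t u v => by simp; ring)
    (fun u v w => by simp; ring) (fun t u v => by simp; ring)

@[simp]
theorem form_apply (u v : TrivialTStar K A) :
    form K A u v = u.covec v.vec + v.covec u.vec := rfl

end TrivialTStar

/-- The abelian complex Lie algebra `ℂⁿ`. -/
@[ext]
structure AbelianLie (n : ℕ) where
  coord : Fin n → ℂ

namespace AbelianLie

variable {n : ℕ}

/-- The identification of the underlying vector space with `ℂⁿ`. -/
def toFun : AbelianLie n ≃ (Fin n → ℂ) where
  toFun := coord
  invFun := mk
  left_inv _ := rfl
  right_inv _ := rfl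

noncomputable instance : AddCommGroup (AbelianLie n) := toFun.addCommGroup

noncomputable instance : Module ℂ (AbelianLie n) := toFun.module ℂ

noncomputable instance : LieRing (AbelianLie n) where
  bracket _ _ := 0
  add_lie _ _ _ := (add_zero 0).symm
  lie_add _ _ _ := (add_zero 0).symm
  lie_self _ := rfl
  leibniz_lie _ _ _ := (add_zero 0).symm

noncomputable instance : LieAlgebra ℂ (AbelianLie n) where
  lie_smul t _ _ := (smul_zero t).symm

end AbelianLie

/-- The complex Heisenberg Lie algebra `𝓛₂`: in the standard basis `x₁, x₂, x₃` of `ℂ³` the only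
non-trivial bracket is `[x₁, x₂] = x₃`. The fields are the coordinates in this basis. -/
@[ext]
structure HeisenbergLie where
  x₁ : ℂ
  x₂ : ℂ
  x₃ : ℂ

namespace HeisenbergLie

/-- The identification of the underlying vector space with `ℂ³`. -/
def toFun : HeisenbergLie ≃ (Fin 3 → ℂ) where
  toFun v := ![v.x₁, v.x₂, v.x₃]
  invFun f := ⟨f 0, f 1, f 2⟩
  left_inv _ := rfl
  right_inv f := by ext i; fin_cases i <;> rfl

noncomputable instance : AddCommGroup HeisenbergLie := toFun.addCommGroup

noncomputable instance : Module ℂ HeisenbergLie := toFun.module ℂ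

noncomputable instance : Bracket HeisenbergLie HeisenbergLie where
  bracket u v := ⟨0, 0, u.x₁ * v.x₂ - u.x₂ * v.x₁⟩

theorem zero_eq_mk : (0 : HeisenbergLie) = ⟨0, 0, 0⟩ := rfl

theorem add_eq_mk (u v : HeisenbergLie) :
    u + v = ⟨u.x₁ + v.x₁, u.x₂ + v.x₂, u.x₃ + v.x₃⟩ := rfl

theorem smul_eq_mk (t : ℂ) (u : HeisenbergLie) :
    t • u = ⟨t * u.x₁, t * u.x₂, t * u.x₃⟩ := rfl

theorem lie_eq_mk (u v : HeisenbergLie) :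
    ⁅u, v⁆ = ⟨0, 0, u.x₁ * v.x₂ - u.x₂ * v.x₁⟩ := rfl

noncomputable instance : LieRing HeisenbergLie where
  add_lie u v w := by ext <;> simp only [add_eq_mk, lie_eq_mk] <;> ring
  lie_add u v w := by ext <;> simp only [add_eq_mk, lie_eq_mk] <;> ring
  lie_self u := by simp only [zero_eq_mk, lie_eq_mk, mul_comm, sub_self]
  leibniz_lie u v w := by ext <;> simp only [add_eq_mk, lie_eq_mk] <;> ring

noncomputable instance : LieAlgebra ℂ HeisenbergLie where
  lie_smul t u v := by ext <;> simp only [smul_eq_mk, lie_eq_mk] <;> ring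

end HeisenbergLie

/-- The complex filiform Lie algebra `𝓛₃`: in the standard basis `x₁, x₂, x₃, x₄` of `ℂ⁴` the only
non-trivial brackets are `[x₁, x₂] = x₃` and `[x₁, x₃] = x₄`. The fields are the coordinates in
this basis. -/
@[ext]
structure FiliformLie where
  x₁ : ℂ
  x₂ : ℂ
  x₃ : ℂ
  x₄ : ℂ

namespace FiliformLie

/-- The identification of the underlying vector space with `ℂ⁴`. -/
def toFun : FiliformLie ≃ (Fin 4 → ℂ) where
  toFun v := ![v.x₁, v.x₂, v.x₃, v.x₄]
  invFun f := ⟨f 0, f 1, f 2, f 3⟩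
  left_inv _ := rfl
  right_inv f := by ext i; fin_cases i <;> rfl

noncomputable instance : AddCommGroup FiliformLie := toFun.addCommGroup

noncomputable instance : Module ℂ FiliformLie := toFun.module ℂ

noncomputable instance : Bracket FiliformLie FiliformLie where
  bracket u v := ⟨0, 0, u.x₁ * v.x₂ - u.x₂ * v.x₁, u.x₁ * v.x₃ - u.x₃ * v.x₁⟩

theorem zero_eq_mk : (0 : FiliformLie) = ⟨0, 0, 0, 0⟩ := rfl

theorem add_eq_mk (u v : FiliformLie) :
    u + v = ⟨u.x₁ + v.x₁, u.x₂ + v.x₂, u.x₃ + v.x₃, u.x₄ + v.x₄⟩ := rfl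

theorem smul_eq_mk (t : ℂ) (u : FiliformLie) :
    t • u = ⟨t * u.x₁, t * u.x₂, t * u.x₃, t * u.x₄⟩ := rfl

theorem lie_eq_mk (u v : FiliformLie) :
    ⁅u, v⁆ = ⟨0, 0, u.x₁ * v.x₂ - u.x₂ * v.x₁, u.x₁ * v.x₃ - u.x₃ * v.x₁⟩ := rfl

noncomputable instance : LieRing FiliformLie where
  add_lie u v w := by ext <;> simp only [add_eq_mk, lie_eq_mk] <;> ring
  lie_add u v w := by ext <;> simp only [add_eq_mk, lie_eq_mk] <;> ring
  lie_self u := by simp only [zero_eq_mk, lie_eq_mk, mul_comm, sub_self]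
  leibniz_lie u v w := by ext <;> simp only [add_eq_mk, lie_eq_mk] <;> ring

noncomputable instance : LieAlgebra ℂ FiliformLie where
  lie_smul t u v := by ext <;> simp only [smul_eq_mk, lie_eq_mk] <;> ring

end FiliformLie

open Module

/-! Writing ω(x, y) = B(Dx, y) turns a symplectic structure into an injective B-skew derivation D.
Its eigenvalues are nonzero, generalized eigenspaces multiply additively under the bracket, and B
pairs the eigenspaces of z and z' trivially unless z + z' = 0. Ordering ℂ lexicographically splits L
into a positive and a negative part. These are Lagrangian subalgebras in duality under B, with dual
bases e and f. If both are sorted by weight, [e i, e j] involves only those e k whose weight is the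
sum of two positive weights, so i, j < k, and likewise for f. This is
`IsInvariantScalarProduct.exists_triangularPair`.

Invariance expresses [e i, f j] through the structure constants of the two subalgebras
(`IsTriangularPair.lie_e_f`), so for n ≤ 4 very few constants remain. The Jacobi identity kills
almost all products of a constant of e with a constant of f. When one subalgebra is abelian, L is
the trivial T*-extension of the other (`isometricallyIsomorphic_trivialTStar`), and a change of
basis identifies that one. For n = 4 both may be non-abelian;
`IsTriangularPair.Table.filiform_of_mixed` then finds another Lagrangian splitting, mixing e and f,
whose second half is abelian. -/

/-- If endomorphisms of `M`, `N`, `Q` satisfy the Leibniz rule with respect to a bilinear map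
`M → N → Q`, then the bilinear map adds generalized eigenvalues. -/
theorem Module.End.apply_mem_maxGenEigenspace_add {K M N Q : Type*} [Field K] [AddCommGroup M]
    [AddCommGroup N] [AddCommGroup Q] [Module K M] [Module K N] [Module K Q]
    (β : M →ₗ[K] N →ₗ[K] Q) (DM : End K M) (DN : End K N) (DQ : End K Q)
    (hD : ∀ x y, DQ (β x y) = β (DM x) y + β x (DN y)) {a b : K} {x : M} {y : N}
    (hx : x ∈ DM.maxGenEigenspace a) (hy : y ∈ DN.maxGenEigenspace b) :
    β x y ∈ DQ.maxGenEigenspace (a + b) := by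
  obtain ⟨k, hk⟩ := (End.mem_maxGenEigenspace _ _ _).1 hx
  obtain ⟨l, hl⟩ := (End.mem_maxGenEigenspace _ _ _).1 hy
  clear hx hy
  induction h : k + l generalizing k l x y with
  | zero =>
    obtain rfl : k = 0 := by omega
    simp only [pow_zero, End.one_apply] at hk
    simp [hk]
  | succ m ih =>
    -- Induction on k + l: each of the two terms lowers one of the nilpotency exponents by one, and
    -- vanishes outright if that exponent is already 0.
    have key : (DQ - (a + b) • (1 : End K Q)) (β x y) =
        β ((DM - a • (1 : End K M)) x) y + β x ((DN - b • (1 : End K N)) y) := by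
      simp only [LinearMap.sub_apply, LinearMap.smul_apply, End.one_apply, hD, map_sub, map_smul]
      module
    have hmem : (DQ - (a + b) • (1 : End K Q)) (β x y) ∈ DQ.maxGenEigenspace (a + b) := by
      rw [key]
      refine add_mem ?_ ?_
      · rcases k with _ | k
        · simp only [pow_zero, End.one_apply] at hk
          simp [hk]
        · exact ih k (by simpa [pow_succ] using hk) l hl (by omega)
      · rcases l with _ | l
        · simp only [pow_zero, End.one_apply] at hl
          simp [hl]
        · exact ih k hk l (by simpa [pow_succ] using hl) (by omega)
    obtain ⟨j, hj⟩ := (End.mem_maxGenEigenspace _ _ _).1 hmem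
    exact (End.mem_maxGenEigenspace _ _ _).2 ⟨j + 1, by simpa [pow_succ] using hj⟩

/-! ### Weight decomposition for the derivation attached to a symplectic structure -/

section Weights

variable {L : Type*} [LieRing L] [LieAlgebra ℂ L] {B : LinearMap.BilinForm ℂ L}

theorem IsInvariantScalarProduct.eq_zero_of_forall (hB : IsInvariantScalarProduct B) {v : L}
    (h : ∀ w, B v w = 0) : v = 0 :=
  hB.nondegenerate.1 v h

/-- A symplectic structure on a quadratic Lie algebra is given by an injective skew-symmetric
derivation. -/
theorem IsInvariantScalarProduct.exists_derivation [FiniteDimensional ℂ L]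
    (hB : IsInvariantScalarProduct B) {ω : LinearMap.BilinForm ℂ L}
    (hω : IsSymplecticStructure ω) :
    ∃ D : End ℂ L, (∀ x, D x = 0 → x = 0) ∧ (∀ x y, B (D x) y + B x (D y) = 0) ∧
      ∀ x y, D ⁅x, y⁆ = ⁅D x, y⁆ + ⁅x, D y⁆ := by
  set D : End ℂ L := ω.symmCompOfNondegenerate B hB.nondegenerate
  have hD : ∀ x y, B (D x) y = ω x y := fun x y =>
    LinearMap.BilinForm.symmCompOfNondegenerate_left_apply ω hB.nondegenerate y x
  refine ⟨D, fun x hx => hω.nondegenerate.1 x fun y => by rw [← hD, hx]; simp, fun x y => ?_,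
    fun x y => ?_⟩
  · rw [hB.symm x, hD, hD, hω.skew]; ring
  · rw [← sub_eq_zero]
    refine hB.eq_zero_of_forall fun z => ?_
    have h1 : B ⁅D x, y⁆ z = ω x ⁅y, z⁆ := by rw [hB.invariant, hD]
    have h2 : B ⁅x, D y⁆ z = ω y ⁅z, x⁆ := by
      rw [← hD, ← lie_skew, ← lie_skew z x]
      simp only [map_neg, LinearMap.neg_apply, hB.invariant]
    have h3 := hω.cocycle x y z
    simp only [map_sub, map_add, LinearMap.sub_apply, LinearMap.add_apply, hD, h1, h2]
    rw [hω.skew x, hω.skew y]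
    linear_combination h3

/-- Vectors `e i`, `f i` forming a hyperbolic basis of a quadratic Lie algebra in which the `e i`
and the `f i` span subalgebras, both with triangular structure constants. -/
structure IsTriangularPair (B : LinearMap.BilinForm ℂ L) {n : ℕ} (e f : Fin n → L) : Prop where
  apply_e_e : ∀ i j, B (e i) (e j) = 0
  apply_f_f : ∀ i j, B (f i) (f j) = 0
  apply_e_f : ∀ i j, B (e i) (f j) = if i = j then 1 else 0
  separating : ∀ v, (∀ i, B v (e i) = 0) → (∀ i, B v (f i) = 0) → v = 0
  lie_e_e_e : ∀ i j k, B ⁅e i, e j⁆ (e k) = 0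
  lie_f_f_f : ∀ i j k, B ⁅f i, f j⁆ (f k) = 0
  lie_e_e_f : ∀ i j k, ¬(i < k ∧ j < k) → B ⁅e i, e j⁆ (f k) = 0
  lie_f_f_e : ∀ i j k, ¬(i < k ∧ j < k) → B ⁅f i, f j⁆ (e k) = 0

/-- The lexicographic order embedding of the additive group `ℂ`. -/
noncomputable def Complex.toLexProd : ℂ →+ ℝ ×ₗ ℝ where
  toFun z := toLex (z.re, z.im)
  map_zero' := rfl
  map_add' _ _ := rfl

theorem Complex.toLexProd_eq_zero {z : ℂ} : Complex.toLexProd z = 0 ↔ z = 0 := by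
  constructor
  · intro h
    have h' : (z.re, z.im) = ((0 : ℝ), (0 : ℝ)) := h
    exact Complex.ext (congrArg Prod.fst h') (congrArg Prod.snd h')
  · rintro rfl; exact map_zero _

/-- Skewness is the Leibniz rule for β when ℂ carries the zero endomorphism. The only generalized
eigenvalue of that endomorphism is 0. -/
theorem Module.End.pairing_eq_zero {M : Type*} [AddCommGroup M] [Module ℂ M]
    (β : LinearMap.BilinForm ℂ M) {D : End ℂ M} (hD : ∀ x y, β (D x) y + β x (D y) = 0)
    {a b : ℂ} {x y : M} (hx : x ∈ D.maxGenEigenspace a) (hy : y ∈ D.maxGenEigenspace b)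
    (hab : a + b ≠ 0) : β x y = 0 := by
  have h := End.apply_mem_maxGenEigenspace_add β D D (0 : End ℂ ℂ)
    (fun x y => by rw [hD]; rfl) hx hy
  obtain ⟨k, hk⟩ := (End.mem_maxGenEigenspace _ _ _).1 h
  have : ((0 : End ℂ ℂ) - (a + b) • (1 : End ℂ ℂ)) = (-(a + b)) • 1 := by module
  rw [this, smul_pow, one_pow, LinearMap.smul_apply, End.one_apply, smul_eq_mul] at hk
  exact (mul_eq_zero.1 hk).resolve_left (pow_ne_zero _ (neg_ne_zero.2 hab))

/-- There is a basis of generalized eigenvectors, with nonzero eigenvalues when `D` is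
injective, and the dual basis consists of generalized eigenvectors for the opposite values. -/
theorem Module.End.exists_weight_basis [FiniteDimensional ℂ L] (hB : IsInvariantScalarProduct B)
    {D : End ℂ L} (hinj : ∀ x, D x = 0 → x = 0) (hskew : ∀ x y, B (D x) y + B x (D y) = 0) :
    ∃ (m : ℕ) (w : Fin m → ℂ) (b b' : Basis (Fin m) ℂ L),
      (∀ s, w s ≠ 0) ∧ (∀ s, b s ∈ D.maxGenEigenspace (w s)) ∧
      (∀ s, b' s ∈ D.maxGenEigenspace (-w s)) ∧
      ∀ s t, B (b s) (b' t) = if s = t then 1 else 0 := by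
  classical
  have hint : DirectSum.IsInternal D.maxGenEigenspace :=
    DirectSum.isInternal_submodule_of_iSupIndep_of_iSup_eq_top D.independent_maxGenEigenspace
      D.iSup_maxGenEigenspace_eq_top
  let c := hint.collectedBasis fun z => Basis.ofVectorSpace ℂ (D.maxGenEigenspace z)
  have : Finite (Σ z : ℂ, Basis.ofVectorSpaceIndex ℂ (D.maxGenEigenspace z)) :=
    Module.Finite.finite_basis c
  obtain ⟨m, ⟨σ⟩⟩ := Finite.exists_equiv_fin
    (Σ z : ℂ, Basis.ofVectorSpaceIndex ℂ (D.maxGenEigenspace z))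
  let b : Basis (Fin m) ℂ L := c.reindex σ
  let w : Fin m → ℂ := fun s => (σ.symm s).1
  have hb : ∀ s, b s ∈ D.maxGenEigenspace (w s) := fun s => by
    simp only [b, Basis.reindex_apply]
    exact hint.collectedBasis_mem _ _
  let b' := B.dualBasis hB.nondegenerate b
  have hbb' : ∀ s t, B (b s) (b' t) = if s = t then 1 else 0 := fun s t => by
    rw [hB.symm]
    exact LinearMap.BilinForm.apply_dualBasis_left hB.nondegenerate b t s
  refine ⟨m, w, b, b', fun s hs => ?_, hb, fun s => ?_, hbb'⟩
  · have h := hb s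
    rw [hs] at h
    obtain ⟨k, hk⟩ := (End.mem_maxGenEigenspace _ _ _).1 h
    have hzero : ∀ k : ℕ, ∀ x : L, ((D - (0 : ℂ) • (1 : End ℂ L)) ^ k) x = 0 → x = 0 := by
      intro k
      induction k with
      | zero => intro x hx; simpa using hx
      | succ k ih =>
        intro x hx
        rw [pow_succ, Module.End.mul_apply] at hx
        exact hinj x (by simpa using ih _ hx)
    exact b.ne_zero s (hzero k _ hk)
  -- Here u is the component of `b' s` of weight `-w s`. The difference `b' s - u` is orthogonal to
  -- every basis vector `b v`: by weights if `w v = w s`, and otherwise because u and `b' s` are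
  -- each orthogonal to `b v`.
  · set u : L := ∑ t with w t = -w s, b.repr (b' s) t • b t
    have hu : u ∈ D.maxGenEigenspace (-w s) := Submodule.sum_mem _ fun t ht =>
      Submodule.smul_mem _ _ ((Finset.mem_filter.1 ht).2 ▸ hb t)
    have hr : b' s - u = ∑ t with ¬ w t = -w s, b.repr (b' s) t • b t := by
      rw [sub_eq_iff_eq_add', Finset.sum_filter_add_sum_filter_not, b.sum_repr]
    have : b' s - u = 0 := by
      refine hB.eq_zero_of_forall fun y => ?_
      have : B (b' s - u) = 0 := b.ext fun v => by
        by_cases hv : w v = w s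
        · rw [hr, map_sum, LinearMap.sum_apply]
          refine Finset.sum_eq_zero fun t ht => ?_
          rw [map_smul, LinearMap.smul_apply,
            Module.End.pairing_eq_zero B hskew (hb t) (hb v), smul_zero]
          intro h0
          exact (Finset.mem_filter.1 ht).2 (by rw [← hv]; exact eq_neg_of_add_eq_zero_left h0)
        · rw [map_sub, LinearMap.sub_apply, Module.End.pairing_eq_zero B hskew hu (hb v),
            hB.symm, hbb', if_neg (by rintro rfl; exact hv rfl)]
          · simp
          · intro h0
            exact hv (by linear_combination h0)
      rw [this]; rfl
    rw [sub_eq_zero.1 this]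
    exact hu

/-- The e are the basis vectors of positive weight and the f their duals, of negative weight. Every
vanishing statement about B holds because the weights involved do not sum to zero. -/
theorem IsInvariantScalarProduct.exists_triangularPair [FiniteDimensional ℂ L]
    (hB : IsInvariantScalarProduct B) {ω : LinearMap.BilinForm ℂ L}
    (hω : IsSymplecticStructure ω) :
    ∃ (n : ℕ) (e f : Fin n → L), IsTriangularPair B e f := by
  classical
  obtain ⟨D, hinj, hskew, hder⟩ := hB.exists_derivation hω
  obtain ⟨m, w, b, b', hw, hb, hb', hbb'⟩ := Module.End.exists_weight_basis hB hinj hskew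
  have hlie : ∀ {z z' : ℂ} {x y : L}, x ∈ D.maxGenEigenspace z → y ∈ D.maxGenEigenspace z' →
      ⁅x, y⁆ ∈ D.maxGenEigenspace (z + z') := fun {z z' x y} hx hy =>
    End.apply_mem_maxGenEigenspace_add (LieModule.toEnd ℂ L L : L →ₗ[ℂ] End ℂ L) D D D hder hx hy
  have hpair : ∀ {z z' : ℂ} {x y : L}, x ∈ D.maxGenEigenspace z → y ∈ D.maxGenEigenspace z' →
      Complex.toLexProd (z + z') ≠ 0 → B x y = 0 := fun hx hy h =>
    Module.End.pairing_eq_zero B hskew hx hy (fun h0 => h (Complex.toLexProd_eq_zero.2 h0))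
  let T := {s : Fin m // 0 < Complex.toLexProd (w s)}
  obtain ⟨n, ⟨σ⟩⟩ := Finite.exists_equiv_fin T
  let p₀ : Fin n → ℝ ×ₗ ℝ := fun i => Complex.toLexProd (w (σ.symm i).1)
  -- τ enumerates the positive-weight basis vectors in order of increasing weight; ties are
  -- harmless, since only monotonicity of p is used.
  let τ : Fin n → Fin m := fun i => (σ.symm (Tuple.sort p₀ i)).1
  let p : Fin n → ℝ ×ₗ ℝ := fun i => Complex.toLexProd (w (τ i))
  have hp : Monotone p := Tuple.monotone_sort p₀
  have hpos : ∀ i, 0 < p i := fun i => (σ.symm (Tuple.sort p₀ i)).2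
  have hτinj : Function.Injective τ := fun i j h => by
    simpa [τ, Subtype.val_inj] using h
  have hτsurj : ∀ s, 0 < Complex.toLexProd (w s) → ∃ i, τ i = s := fun s hs =>
    ⟨(Tuple.sort p₀).symm (σ ⟨s, hs⟩), by simp [τ]⟩
  -- If k ≤ i then p k ≤ p i < p i + p j, as all weights are positive; this is the source of
  -- triangularity.
  have htri : ∀ i j k, ¬(i < k ∧ j < k) → p i + p j ≠ p k := by
    intro i j k h h0
    refine h ⟨lt_of_not_ge fun hk => ?_, lt_of_not_ge fun hk => ?_⟩
    · have := hp hk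
      exact absurd h0 (ne_of_gt (lt_of_le_of_lt this (lt_add_of_pos_right _ (hpos j))))
    · have := hp hk
      exact absurd h0 (ne_of_gt (lt_of_le_of_lt this (lt_add_of_pos_left _ (hpos i))))
  refine ⟨n, fun i => b (τ i), fun i => b' (τ i), ?_, ?_, ?_, ?_, ?_, ?_, ?_, ?_⟩
  · intro i j
    refine hpair (hb _) (hb _) ?_
    rw [map_add]
    exact ne_of_gt (add_pos (hpos i) (hpos j))
  · intro i j
    refine hpair (hb' _) (hb' _) ?_
    rw [map_add, map_neg, map_neg, ← neg_add]
    exact neg_ne_zero.2 (ne_of_gt (add_pos (hpos i) (hpos j)))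
  · intro i j
    simp [hbb', hτinj.eq_iff]
  · intro v h1 h2
    have hrepr : ∀ t, b.repr v t = B v (b' t) := by
      intro t
      conv_rhs => rw [← b.sum_repr v, map_sum, LinearMap.sum_apply]
      simp only [map_smul, LinearMap.smul_apply, hbb', smul_eq_mul, mul_ite, mul_one, mul_zero,
        Finset.sum_ite_eq', Finset.mem_univ, if_true]
    refine hB.eq_zero_of_forall fun y => ?_
    have hneg : ∀ s, ¬ 0 < Complex.toLexProd (w s) → Complex.toLexProd (w s) < 0 := fun s hs =>
      lt_of_le_of_ne (not_lt.1 hs) fun h => hw s (Complex.toLexProd_eq_zero.1 h)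
    -- Orthogonality to the f removes the positive-weight coordinates of v. What is left has
    -- negative weights, so it is orthogonal to all negative-weight vectors, while the e are covered
    -- by hypothesis.
    have : B v = 0 := b.ext fun s => by
      by_cases hs : 0 < Complex.toLexProd (w s)
      · obtain ⟨i, rfl⟩ := hτsurj s hs
        exact h1 i
      · rw [← b.sum_repr v, map_sum, LinearMap.sum_apply]
        refine Finset.sum_eq_zero fun t _ => ?_
        rw [map_smul, LinearMap.smul_apply]
        by_cases ht : 0 < Complex.toLexProd (w t)
        · obtain ⟨i, rfl⟩ := hτsurj t ht
          rw [hrepr, h2, zero_smul]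
        · rw [hpair (hb t) (hb s), smul_zero]
          rw [map_add]
          exact ne_of_lt (add_neg (hneg t ht) (hneg s hs))
    rw [this]; rfl
  · intro i j k
    refine hpair (hlie (hb _) (hb _)) (hb _) ?_
    rw [map_add, map_add]
    exact ne_of_gt (add_pos (add_pos (hpos i) (hpos j)) (hpos k))
  · intro i j k
    refine hpair (hlie (hb' _) (hb' _)) (hb' _) ?_
    simp only [map_add, map_neg, ← neg_add]
    exact neg_ne_zero.2 (ne_of_gt (add_pos (add_pos (hpos i) (hpos j)) (hpos k)))
  · intro i j k h
    refine hpair (hlie (hb _) (hb _)) (hb' _) ?_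
    rw [map_add, map_add, map_neg, ← sub_eq_add_neg]
    exact sub_ne_zero.2 (htri i j k h)
  · intro i j k h
    refine hpair (hlie (hb' _) (hb' _)) (hb _) ?_
    simp only [map_add, map_neg, ← neg_add]
    rw [neg_add_eq_sub]
    exact sub_ne_zero.2 (htri i j k h).symm

end Weights

/-! ### Recognizing a trivial T*-extension -/

section TStar

variable {L : Type*} [LieRing L] [LieAlgebra ℂ L] {B : LinearMap.BilinForm ℂ L}
variable {A : Type*} [LieRing A] [LieAlgebra ℂ A]

/-- The identification of `T*₀ 𝔞` with `𝔞 × 𝔞*` is linear. -/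
noncomputable def TrivialTStar.linearEquivProd : TrivialTStar ℂ A ≃ₗ[ℂ] A × Dual ℂ A :=
  { TrivialTStar.toProd with
    map_add' := fun _ _ => rfl
    map_smul' := fun _ _ => rfl }

/-- A quadratic Lie algebra which is the sum of a Lagrangian subalgebra `𝔞` and a Lagrangian
abelian subalgebra is isometrically isomorphic to `T*₀ 𝔞`. -/
theorem isometricallyIsomorphic_trivialTStar [FiniteDimensional ℂ L] [FiniteDimensional ℂ A]
    (hB : IsInvariantScalarProduct B) (φ : A →ₗ[ℂ] L) (ψ : Dual ℂ A →ₗ[ℂ] L)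
    (hrank : finrank ℂ L = 2 * finrank ℂ A)
    (hφφ : ∀ x y, B (φ x) (φ y) = 0) (hψψ : ∀ g h, B (ψ g) (ψ h) = 0)
    (hφψ : ∀ x g, B (φ x) (ψ g) = g x) (hφ : ∀ x y, φ ⁅x, y⁆ = ⁅φ x, φ y⁆)
    (hψ : ∀ g h, ⁅ψ g, ψ h⁆ = 0) :
    IsometricallyIsomorphic B (TrivialTStar.form ℂ A) := by
  have hψφ : ∀ g x, B (ψ g) (φ x) = g x := fun g x => by rw [hB.symm, hφψ]
  let Ψ : TrivialTStar ℂ A →ₗ[ℂ] L :=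
    (φ.coprod ψ) ∘ₗ (TrivialTStar.linearEquivProd : TrivialTStar ℂ A ≃ₗ[ℂ] _).toLinearMap
  have hΨ : ∀ u, Ψ u = φ u.vec + ψ u.covec := fun u => rfl
  have hform : ∀ u v, B (Ψ u) (Ψ v) = TrivialTStar.form ℂ A u v := fun u v => by
    simp only [hΨ, map_add, LinearMap.add_apply, hφφ, hψψ, hφψ, hψφ, TrivialTStar.form_apply]
    ring
  -- An isometry from a nondegenerate form is injective; the dimension count then makes it
  -- bijective.
  have hinj : Function.Injective Ψ := by
    rw [← LinearMap.ker_eq_bot, LinearMap.ker_eq_bot']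
    intro u hu
    have h : ∀ v, TrivialTStar.form ℂ A u v = 0 := fun v => by rw [← hform, hu]; simp
    have h1 : u.vec = 0 := (forall_dual_apply_eq_zero_iff ℂ _).1 fun g => by
      simpa using h ⟨0, g⟩
    have h2 : u.covec = 0 := LinearMap.ext fun x => by simpa using h ⟨x, 0⟩
    exact TrivialTStar.ext h1 h2
  have : FiniteDimensional ℂ (TrivialTStar ℂ A) :=
    Module.Finite.equiv (TrivialTStar.linearEquivProd (A := A)).symm
  have hfr : finrank ℂ (TrivialTStar ℂ A) = finrank ℂ L := by
    rw [(TrivialTStar.linearEquivProd (A := A)).finrank_eq, finrank_prod,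
      Subspace.dual_finrank_eq, hrank, two_mul]
  have hbij : Function.Bijective Ψ :=
    ⟨hinj, (LinearMap.injective_iff_surjective_of_finrank_eq_finrank hfr).1 hinj⟩
  -- The mixed brackets are forced by invariance: pairing with the image of φ evaluates g on a
  -- bracket of 𝔞, and pairing with the image of ψ vanishes because that image is abelian.
  have hmixed : ∀ x g, ⁅φ x, ψ g⁆ = -ψ (g ∘ₗ LieAlgebra.ad ℂ A x) := by
    intro x g
    rw [← sub_eq_zero]
    refine hB.nondegenerate.1 _ fun y => ?_
    obtain ⟨v, rfl⟩ := hbij.2 y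
    have h1 : B ⁅φ x, ψ g⁆ (φ v.vec) = -g ⁅x, v.vec⁆ := by
      rw [← lie_skew, map_neg, LinearMap.neg_apply, hB.invariant, ← hφ, hψφ]
    have h2 : B ⁅φ x, ψ g⁆ (ψ v.covec) = 0 := by rw [hB.invariant, hψ, map_zero]
    simp only [hΨ, map_sub, map_add, map_neg, LinearMap.sub_apply, LinearMap.neg_apply, h1, h2,
      hψφ, hψψ, LinearMap.comp_apply, LieAlgebra.ad_apply]
    ring
  have hlie : ∀ u v, Ψ ⁅u, v⁆ = ⁅Ψ u, Ψ v⁆ := by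
    intro u v
    have h : ⁅ψ u.covec, φ v.vec⁆ = ψ (u.covec ∘ₗ LieAlgebra.ad ℂ A v.vec) := by
      rw [← lie_skew, hmixed, neg_neg]
    simp only [hΨ, TrivialTStar.lie_vec, TrivialTStar.lie_covec, lie_add, add_lie, hφ, hψ, hmixed,
      h, map_sub]
    abel
  let E : TrivialTStar ℂ A ≃ₗ⁅ℂ⁆ L :=
    { LinearEquiv.ofBijective Ψ hbij with map_lie' := fun {u v} => hlie u v }
  have hE : ∀ u, E u = Ψ u := fun _ => rfl
  refine ⟨E.symm, fun x y => ?_⟩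
  rw [← hform, ← hE, ← hE, E.apply_symm_apply, E.apply_symm_apply]

variable {ι : Type*} [Fintype ι] [DecidableEq ι]

/-- Criterion for an isometric isomorphism with `T*₀ 𝔞` in terms of a basis of `𝔞`. -/
theorem isometricallyIsomorphic_trivialTStar_of_basis [FiniteDimensional ℂ L]
    (hB : IsInvariantScalarProduct B) (b : Basis ι ℂ A) (x y : ι → L)
    (hrank : finrank ℂ L = 2 * Fintype.card ι)
    (hxx : ∀ i j, B (x i) (x j) = 0) (hyy : ∀ i j, B (y i) (y j) = 0)
    (hxy : ∀ i j, B (x i) (y j) = if i = j then 1 else 0)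
    (hx : ∀ i j, ⁅x i, x j⁆ = b.constr ℂ x ⁅b i, b j⁆) (hy : ∀ i j, ⁅y i, y j⁆ = 0) :
    IsometricallyIsomorphic B (TrivialTStar.form ℂ A) := by
  have : FiniteDimensional ℂ A := Module.Finite.of_basis b
  let ψ : Dual ℂ A →ₗ[ℂ] L := b.dualBasis.constr ℂ y
  have hψ : ∀ g, ψ g = ∑ i, g (b i) • y i := fun g => by
    simp [ψ, Basis.constr_apply_fintype]
  refine isometricallyIsomorphic_trivialTStar hB (b.constr ℂ x) ψ
    (by rw [hrank, finrank_eq_card_basis b]) ?_ ?_ ?_ ?_ ?_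
  · intro u v
    simp [Basis.constr_apply_fintype, hxx]
  · intro g h
    simp [hψ, hyy]
  · intro u g
    have : (B.flip (ψ g)) ∘ₗ b.constr ℂ x = g := b.ext fun i => by
      simp [hψ, hxy]
    exact LinearMap.congr_fun this u
  · intro u v
    rw [← b.sum_repr u, ← b.sum_repr v]
    simp only [sum_lie, lie_sum, smul_lie, lie_smul, map_sum, map_smul, Basis.constr_basis, hx]
  · intro g h
    simp only [hψ, sum_lie, lie_sum, smul_lie, lie_smul, hy, smul_zero, Finset.sum_const_zero]

end TStar

/-! ### Coordinates on the model algebras -/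

/-- The standard basis of the abelian Lie algebra. -/
noncomputable def AbelianLie.basis (n : ℕ) : Basis (Fin n) ℂ (AbelianLie n) :=
  .ofEquivFun
    { AbelianLie.toFun with
      map_add' := fun _ _ => rfl
      map_smul' := fun _ _ => rfl }

/-- The standard basis of the Heisenberg algebra. -/
noncomputable def HeisenbergLie.basis : Basis (Fin 3) ℂ HeisenbergLie :=
  .ofEquivFun
    { HeisenbergLie.toFun with
      map_add' := fun _ _ => HeisenbergLie.toFun.apply_symm_apply _
      map_smul' := fun _ _ => HeisenbergLie.toFun.apply_symm_apply _ }

/-- The standard basis of the filiform algebra. -/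
noncomputable def FiliformLie.basis : Basis (Fin 4) ℂ FiliformLie :=
  .ofEquivFun
    { FiliformLie.toFun with
      map_add' := fun _ _ => FiliformLie.toFun.apply_symm_apply _
      map_smul' := fun _ _ => FiliformLie.toFun.apply_symm_apply _ }

theorem HeisenbergLie.constr_basis_apply {M : Type*} [AddCommGroup M] [Module ℂ M]
    (x : Fin 3 → M) (v : HeisenbergLie) :
    HeisenbergLie.basis.constr ℂ x v = v.x₁ • x 0 + v.x₂ • x 1 + v.x₃ • x 2 := by
  rw [Basis.constr_apply_fintype, Fin.sum_univ_three]
  rfl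

theorem FiliformLie.constr_basis_apply {M : Type*} [AddCommGroup M] [Module ℂ M]
    (x : Fin 4 → M) (v : FiliformLie) :
    FiliformLie.basis.constr ℂ x v = v.x₁ • x 0 + v.x₂ • x 1 + v.x₃ • x 2 + v.x₄ • x 3 := by
  rw [Basis.constr_apply_fintype, Fin.sum_univ_four]
  rfl

theorem HeisenbergLie.basis_apply (i : Fin 3) :
    HeisenbergLie.basis i =
      ⟨Pi.single (M := fun _ => ℂ) i 1 0, Pi.single (M := fun _ => ℂ) i 1 1,
        Pi.single (M := fun _ => ℂ) i 1 2⟩ := by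
  rw [HeisenbergLie.basis, Basis.coe_ofEquivFun]
  rfl

/-- The standard basis of the direct sum of the Heisenberg algebra and a line. -/
noncomputable def HeisenbergLie.prodBasis : Basis (Fin 4) ℂ (HeisenbergLie × AbelianLie 1) :=
  .ofEquivFun
    { toFun := fun u => ![u.1.x₁, u.1.x₂, u.1.x₃, u.2.coord 0]
      invFun := fun g => (⟨g 0, g 1, g 2⟩, ⟨fun _ => g 3⟩)
      left_inv := fun u => by
        refine Prod.ext rfl (AbelianLie.ext (funext fun i => ?_))
        rw [Subsingleton.elim i 0]
        rfl
      right_inv := fun g => by ext i; fin_cases i <;> rfl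
      map_add' := fun _ _ => by ext i; fin_cases i <;> rfl
      map_smul' := fun _ _ => by ext i; fin_cases i <;> rfl }

theorem HeisenbergLie.constr_prodBasis_apply {M : Type*} [AddCommGroup M] [Module ℂ M]
    (x : Fin 4 → M) (v : HeisenbergLie × AbelianLie 1) :
    HeisenbergLie.prodBasis.constr ℂ x v =
      v.1.x₁ • x 0 + v.1.x₂ • x 1 + v.1.x₃ • x 2 + v.2.coord 0 • x 3 := by
  rw [Basis.constr_apply_fintype, Fin.sum_univ_four]
  rfl

theorem HeisenbergLie.prodBasis_apply (i : Fin 4) :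
    HeisenbergLie.prodBasis i =
      (⟨Pi.single (M := fun _ => ℂ) i 1 0, Pi.single (M := fun _ => ℂ) i 1 1,
        Pi.single (M := fun _ => ℂ) i 1 2⟩, ⟨fun _ => Pi.single (M := fun _ => ℂ) i 1 3⟩) := by
  rw [HeisenbergLie.prodBasis, Basis.coe_ofEquivFun]
  rfl

theorem FiliformLie.basis_apply (i : Fin 4) :
    FiliformLie.basis i =
      ⟨Pi.single (M := fun _ => ℂ) i 1 0, Pi.single (M := fun _ => ℂ) i 1 1,
        Pi.single (M := fun _ => ℂ) i 1 2, Pi.single (M := fun _ => ℂ) i 1 3⟩ := by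
  rw [FiliformLie.basis, Basis.coe_ofEquivFun]
  rfl

/-! ### Bracket relations that identify each model -/

section Models

variable {L : Type*} [LieRing L] [LieAlgebra ℂ L] [FiniteDimensional ℂ L]
  {B : LinearMap.BilinForm ℂ L}

/-- A hyperbolic basis `x i`, `y i` of `L` in which the `y i` commute. -/
structure IsHyperbolic (B : LinearMap.BilinForm ℂ L) {n : ℕ} (x y : Fin n → L) : Prop where
  finrank_eq : finrank ℂ L = 2 * n
  apply_x_x : ∀ i j, B (x i) (x j) = 0
  apply_y_y : ∀ i j, B (y i) (y j) = 0
  apply_x_y : ∀ i j, B (x i) (y j) = if i = j then 1 else 0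
  lie_y_y : ∀ i j, ⁅y i, y j⁆ = 0

theorem IsHyperbolic.abelian (hB : IsInvariantScalarProduct B) {n : ℕ} {x y : Fin n → L}
    (h : IsHyperbolic B x y) (hx : ∀ i j, ⁅x i, x j⁆ = 0) :
    IsometricallyIsomorphic B (TrivialTStar.form ℂ (AbelianLie n)) :=
  isometricallyIsomorphic_trivialTStar_of_basis hB (AbelianLie.basis n) x y
    (by simpa using h.finrank_eq) h.apply_x_x h.apply_y_y h.apply_x_y
    (fun i j => (hx i j).trans (map_zero _).symm) h.lie_y_y

theorem IsHyperbolic.heisenberg (hB : IsInvariantScalarProduct B) {x y : Fin 3 → L}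
    (h : IsHyperbolic B x y) (h01 : ⁅x 0, x 1⁆ = x 2) (h02 : ⁅x 0, x 2⁆ = 0)
    (h12 : ⁅x 1, x 2⁆ = 0) :
    IsometricallyIsomorphic B (TrivialTStar.form ℂ HeisenbergLie) := by
  have h10 : ⁅x 1, x 0⁆ = -x 2 := by rw [← lie_skew, h01]
  have h20 : ⁅x 2, x 0⁆ = 0 := by rw [← lie_skew, h02, neg_zero]
  have h21 : ⁅x 2, x 1⁆ = 0 := by rw [← lie_skew, h12, neg_zero]
  refine isometricallyIsomorphic_trivialTStar_of_basis hB HeisenbergLie.basis x y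
    (by simpa using h.finrank_eq) h.apply_x_x h.apply_y_y h.apply_x_y (fun i j => ?_) h.lie_y_y
  rw [HeisenbergLie.constr_basis_apply, HeisenbergLie.basis_apply, HeisenbergLie.basis_apply,
    HeisenbergLie.lie_eq_mk]
  fin_cases i <;> fin_cases j <;> simp [h01, h02, h12, h10, h20, h21]

theorem IsHyperbolic.filiform (hB : IsInvariantScalarProduct B) {x y : Fin 4 → L}
    (h : IsHyperbolic B x y) (h01 : ⁅x 0, x 1⁆ = x 2) (h02 : ⁅x 0, x 2⁆ = x 3)
    (h03 : ⁅x 0, x 3⁆ = 0) (h12 : ⁅x 1, x 2⁆ = 0) (h13 : ⁅x 1, x 3⁆ = 0) (h23 : ⁅x 2, x 3⁆ = 0) :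
    IsometricallyIsomorphic B (TrivialTStar.form ℂ FiliformLie) := by
  have h10 : ⁅x 1, x 0⁆ = -x 2 := by rw [← lie_skew, h01]
  have h20 : ⁅x 2, x 0⁆ = -x 3 := by rw [← lie_skew, h02]
  have h30 : ⁅x 3, x 0⁆ = 0 := by rw [← lie_skew, h03, neg_zero]
  have h21 : ⁅x 2, x 1⁆ = 0 := by rw [← lie_skew, h12, neg_zero]
  have h31 : ⁅x 3, x 1⁆ = 0 := by rw [← lie_skew, h13, neg_zero]
  have h32 : ⁅x 3, x 2⁆ = 0 := by rw [← lie_skew, h23, neg_zero]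
  refine isometricallyIsomorphic_trivialTStar_of_basis hB FiliformLie.basis x y
    (by simpa using h.finrank_eq) h.apply_x_x h.apply_y_y h.apply_x_y (fun i j => ?_) h.lie_y_y
  rw [FiliformLie.constr_basis_apply, FiliformLie.basis_apply, FiliformLie.basis_apply,
    FiliformLie.lie_eq_mk]
  fin_cases i <;> fin_cases j <;>
    simp [h01, h02, h03, h12, h13, h23, h10, h20, h30, h21, h31, h32]

theorem IsHyperbolic.heisenbergProd (hB : IsInvariantScalarProduct B) {x y : Fin 4 → L}
    (h : IsHyperbolic B x y) (h01 : ⁅x 0, x 1⁆ = x 2) (h02 : ⁅x 0, x 2⁆ = 0)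
    (h03 : ⁅x 0, x 3⁆ = 0) (h12 : ⁅x 1, x 2⁆ = 0) (h13 : ⁅x 1, x 3⁆ = 0) (h23 : ⁅x 2, x 3⁆ = 0) :
    IsometricallyIsomorphic B (TrivialTStar.form ℂ (HeisenbergLie × AbelianLie 1)) := by
  have h10 : ⁅x 1, x 0⁆ = -x 2 := by rw [← lie_skew, h01]
  have h20 : ⁅x 2, x 0⁆ = 0 := by rw [← lie_skew, h02, neg_zero]
  have h30 : ⁅x 3, x 0⁆ = 0 := by rw [← lie_skew, h03, neg_zero]
  have h21 : ⁅x 2, x 1⁆ = 0 := by rw [← lie_skew, h12, neg_zero]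
  have h31 : ⁅x 3, x 1⁆ = 0 := by rw [← lie_skew, h13, neg_zero]
  have h32 : ⁅x 3, x 2⁆ = 0 := by rw [← lie_skew, h23, neg_zero]
  refine isometricallyIsomorphic_trivialTStar_of_basis hB HeisenbergLie.prodBasis x y
    (by simpa using h.finrank_eq) h.apply_x_x h.apply_y_y h.apply_x_y (fun i j => ?_) h.lie_y_y
  have hlie : ∀ u v : HeisenbergLie × AbelianLie 1, ⁅u, v⁆ =
      (⟨0, 0, u.1.x₁ * v.1.x₂ - u.1.x₂ * v.1.x₁⟩, 0) := fun _ _ => rfl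
  have hcoord : (0 : AbelianLie 1).coord 0 = 0 := rfl
  rw [HeisenbergLie.constr_prodBasis_apply, HeisenbergLie.prodBasis_apply,
    HeisenbergLie.prodBasis_apply, hlie]
  fin_cases i <;> fin_cases j <;>
    simp [hcoord, h01, h02, h03, h12, h13, h23, h10, h20, h30, h21, h31, h32]

end Models

/-! ### Brackets in a triangular pair -/

section TriangularPair

variable {L : Type*} [LieRing L] [LieAlgebra ℂ L] {B : LinearMap.BilinForm ℂ L} {n : ℕ}
  {e f : Fin n → L}

/-- Invariance pulls w out of each term and leaves a cyclic Jacobi sum paired with w. In this form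
the Jacobi identity yields scalar relations between structure constants. -/
theorem IsInvariantScalarProduct.jacobi (hB : IsInvariantScalarProduct B) (x y z w : L) :
    B ⁅x, y⁆ ⁅z, w⁆ + B ⁅y, z⁆ ⁅x, w⁆ + B ⁅z, x⁆ ⁅y, w⁆ = 0 := by
  rw [← hB.invariant, ← hB.invariant, ← hB.invariant, ← LinearMap.add_apply, ← map_add,
    ← LinearMap.add_apply, ← map_add]
  have h := lie_jacobi x y z
  have h' : ⁅⁅x, y⁆, z⁆ + ⁅⁅y, z⁆, x⁆ + ⁅⁅z, x⁆, y⁆ = 0 := by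
    rw [← lie_skew z ⁅x, y⁆, ← lie_skew x ⁅y, z⁆, ← lie_skew y ⁅z, x⁆] at h
    rw [← neg_eq_zero, ← h]
    abel
  rw [h']
  simp

theorem IsTriangularPair.apply_f_e (hB : IsInvariantScalarProduct B) (h : IsTriangularPair B e f)
    (i j : Fin n) : B (f i) (e j) = if i = j then 1 else 0 := by
  rw [hB.symm, h.apply_e_f]
  simp only [eq_comm]

/-- The symmetry between positive and negative weights, which halves the case analysis. -/
theorem IsTriangularPair.swap (hB : IsInvariantScalarProduct B) (h : IsTriangularPair B e f) :
    IsTriangularPair B f e where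
  apply_e_e := h.apply_f_f
  apply_f_f := h.apply_e_e
  apply_e_f := h.apply_f_e hB
  separating v h1 h2 := h.separating v h2 h1
  lie_e_e_e := h.lie_f_f_f
  lie_f_f_f := h.lie_e_e_e
  lie_e_e_f := h.lie_f_f_e
  lie_f_f_e := h.lie_e_e_f

theorem IsTriangularPair.eq_sum (hB : IsInvariantScalarProduct B) (h : IsTriangularPair B e f)
    (v : L) : v = ∑ k, B v (f k) • e k + ∑ k, B v (e k) • f k := by
  rw [← sub_eq_zero]
  refine h.separating _ (fun i => ?_) fun i => ?_ <;>
    simp [h.apply_e_e, h.apply_f_f, h.apply_e_f, h.apply_f_e hB]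

theorem IsTriangularPair.finrank_eq (hB : IsInvariantScalarProduct B)
    (h : IsTriangularPair B e f) : finrank ℂ L = 2 * n := by
  let F : L →ₗ[ℂ] (Fin n → ℂ) × (Fin n → ℂ) :=
    (LinearMap.pi fun i => B.flip (f i)).prod (LinearMap.pi fun i => B.flip (e i))
  have hF : Function.Bijective F := by
    refine ⟨?_, fun q => ⟨∑ k, q.1 k • e k + ∑ k, q.2 k • f k, ?_⟩⟩
    · rw [← LinearMap.ker_eq_bot, LinearMap.ker_eq_bot']
      intro v hv
      exact h.separating v (fun i => congrFun (congrArg Prod.snd hv) i)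
        fun i => congrFun (congrArg Prod.fst hv) i
    · refine Prod.ext (funext fun i => ?_) (funext fun i => ?_) <;>
        simp [F, h.apply_e_e, h.apply_f_f, h.apply_e_f, h.apply_f_e hB]
  rw [(LinearEquiv.ofBijective F hF).finrank_eq, finrank_prod, finrank_fin_fun, two_mul]

theorem IsTriangularPair.lie_e_e (hB : IsInvariantScalarProduct B) (h : IsTriangularPair B e f)
    (i j : Fin n) : ⁅e i, e j⁆ = ∑ k, B ⁅e i, e j⁆ (f k) • e k := by
  conv_lhs => rw [h.eq_sum hB ⁅e i, e j⁆]
  simp [h.lie_e_e_e]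

/-- Invariance turns each coefficient of a mixed bracket into a structure constant of one of the two
subalgebras, which therefore determine the whole bracket of L. -/
theorem IsTriangularPair.lie_e_f (hB : IsInvariantScalarProduct B) (h : IsTriangularPair B e f)
    (i j : Fin n) : ⁅e i, f j⁆ =
      ∑ k, B ⁅f j, f k⁆ (e i) • e k - ∑ k, B ⁅e i, e k⁆ (f j) • f k := by
  have h1 : ∀ k, B ⁅e i, f j⁆ (f k) = B ⁅f j, f k⁆ (e i) := fun k => by
    rw [hB.invariant, hB.symm]
  have h2 : ∀ k, B ⁅e i, f j⁆ (e k) = -B ⁅e i, e k⁆ (f j) := fun k => by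
    rw [← lie_skew, map_neg, LinearMap.neg_apply, hB.invariant, hB.symm]
  conv_lhs => rw [h.eq_sum hB ⁅e i, f j⁆]
  simp only [h1, h2, neg_smul, Finset.sum_neg_distrib, sub_eq_add_neg]

theorem IsTriangularPair.isHyperbolic [FiniteDimensional ℂ L] (hB : IsInvariantScalarProduct B)
    (h : IsTriangularPair B e f) (hf : ∀ i j, ⁅f i, f j⁆ = 0) : IsHyperbolic B e f :=
  ⟨h.finrank_eq hB, h.apply_e_e, h.apply_f_f, h.apply_e_f, hf⟩

/-- A nonzero coefficient needs distinct i, j both below k, hence at least three indices. -/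
theorem IsTriangularPair.lie_e_e_eq_zero_of_le_two (hB : IsInvariantScalarProduct B)
    (h : IsTriangularPair B e f) (hn : n ≤ 2) (i j : Fin n) : ⁅e i, e j⁆ = 0 := by
  by_cases hij : i = j
  · rw [hij, lie_self]
  · rw [h.lie_e_e hB]
    refine Finset.sum_eq_zero fun k _ => ?_
    rw [h.lie_e_e_f _ _ _ (by omega), zero_smul]

/-- Supplies the second row of a determinant-one change of basis whose first row is the given
nonzero pair. -/
theorem exists_mul_add_mul_eq_one {c d : ℂ} (h : c ≠ 0 ∨ d ≠ 0) : ∃ p q, p * c + q * d = 1 := by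
  rcases h with h | h
  · exact ⟨c⁻¹, 0, by simp [h]⟩
  · exact ⟨0, d⁻¹, by simp [h]⟩

end TriangularPair

/-! ### Dimension six: one structure constant on each side -/

section DimensionSix

variable {L : Type*} [LieRing L] [LieAlgebra ℂ L] {B : LinearMap.BilinForm ℂ L}
  {e f : Fin 3 → L}

theorem IsTriangularPair.lie_e_e_three (hB : IsInvariantScalarProduct B)
    (h : IsTriangularPair B e f) :
    ⁅e 0, e 1⁆ = B ⁅e 0, e 1⁆ (f 2) • e 2 ∧ ∀ i, ⁅e i, e 2⁆ = 0 := by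
  refine ⟨?_, fun i => ?_⟩
  · conv_lhs => rw [h.lie_e_e hB, Fin.sum_univ_three]
    rw [h.lie_e_e_f 0 1 0 (by decide), h.lie_e_e_f 0 1 1 (by decide)]
    module
  · rw [h.lie_e_e hB]
    refine Finset.sum_eq_zero fun k _ => ?_
    rw [h.lie_e_e_f _ _ _ (by omega), zero_smul]

theorem IsTriangularPair.lie_eq_zero_three (hB : IsInvariantScalarProduct B)
    (h : IsTriangularPair B e f) (h0 : B ⁅e 0, e 1⁆ (f 2) = 0) (i j : Fin 3) :
    ⁅e i, e j⁆ = 0 := by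
  obtain ⟨h01, h2⟩ := h.lie_e_e_three hB
  rw [h0, zero_smul] at h01
  have h10 : ⁅e 1, e 0⁆ = 0 := by rw [← lie_skew, h01, neg_zero]
  have h2' : ∀ i, ⁅e 2, e i⁆ = 0 := fun i => by rw [← lie_skew, h2, neg_zero]
  fin_cases i <;> fin_cases j <;> simp [h01, h10, h2, h2']

/-- In the Jacobi relation for e 0, e 1, f 0, f 1 both mixed terms vanish by triangularity, so only
the product of the two constants is left. -/
theorem IsTriangularPair.mul_eq_zero_three (hB : IsInvariantScalarProduct B)
    (h : IsTriangularPair B e f) : B ⁅e 0, e 1⁆ (f 2) * B ⁅f 0, f 1⁆ (e 2) = 0 := by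
  have hJ := hB.jacobi (e 0) (e 1) (f 0) (f 1)
  have h00 : ⁅e 0, f 1⁆ = 0 := by
    rw [h.lie_e_f hB, Fin.sum_univ_three, Fin.sum_univ_three]
    simp [h.lie_e_e_f, h.lie_f_f_e]
  have h11 : ⁅f 0, e 0⁆ = 0 := by
    rw [← lie_skew, h.lie_e_f hB]
    simp [h.lie_e_e_f, h.lie_f_f_e]
  rw [h00, h11, (h.lie_e_e_three hB).1, ((h.swap hB).lie_e_e_three hB).1] at hJ
  simpa [h.apply_e_f, or_comm] using hJ

theorem IsTriangularPair.heisenberg_of_ne_zero [FiniteDimensional ℂ L]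
    (hB : IsInvariantScalarProduct B) (h : IsTriangularPair B e f)
    (h0 : B ⁅e 0, e 1⁆ (f 2) ≠ 0) :
    IsometricallyIsomorphic B (TrivialTStar.form ℂ HeisenbergLie) := by
  have hf := (h.swap hB).lie_eq_zero_three hB
    ((mul_eq_zero.1 (h.mul_eq_zero_three hB)).resolve_left h0)
  obtain ⟨h01, h2⟩ := h.lie_e_e_three hB
  set a := B ⁅e 0, e 1⁆ (f 2)
  -- The f commute by now; rescaling e 2 normalizes the bracket, and the inverse factor on f 2 keeps
  -- the bases dual.
  refine IsHyperbolic.heisenberg hB (x := ![e 0, e 1, a • e 2]) (y := ![f 0, f 1, a⁻¹ • f 2])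
    ⟨h.finrank_eq hB, ?_, ?_, ?_, ?_⟩ h01 ?_ ?_
  · intro i j; fin_cases i <;> fin_cases j <;> simp [h.apply_e_e]
  · intro i j; fin_cases i <;> fin_cases j <;> simp [h.apply_f_f]
  · intro i j; fin_cases i <;> fin_cases j <;> simp [h.apply_e_f, h0]
  · intro i j; fin_cases i <;> fin_cases j <;> simp [hf]
  · simp [h2]
  · simp [h2]

end DimensionSix

/-! ### Dimension eight: four structure constants on each side -/

section DimensionEight

variable {L : Type*} [LieRing L] [LieAlgebra ℂ L] {B : LinearMap.BilinForm ℂ L}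
  {e f : Fin 4 → L}

/-- The brackets of the `e i` with each other and with the `f i`, in terms of the structure
constants `a, b, c, d` of the `e i` and `a', b', c', d'` of the `f i`. -/
structure IsTriangularPair.Table (e f : Fin 4 → L) (a b c d a' b' c' d' : ℂ) : Prop where
  e01 : ⁅e 0, e 1⁆ = a • e 2 + b • e 3
  e02 : ⁅e 0, e 2⁆ = c • e 3
  e12 : ⁅e 1, e 2⁆ = d • e 3
  ee3 : ∀ i, ⁅e i, e 3⁆ = 0
  f01 : ⁅f 0, f 1⁆ = a' • f 2 + b' • f 3
  f02 : ⁅f 0, f 2⁆ = c' • f 3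
  f12 : ⁅f 1, f 2⁆ = d' • f 3
  ff3 : ∀ i, ⁅f i, f 3⁆ = 0
  e0f0 : ⁅e 0, f 0⁆ = 0
  e0f1 : ⁅e 0, f 1⁆ = 0
  e0f2 : ⁅e 0, f 2⁆ = -(a • f 1)
  e0f3 : ⁅e 0, f 3⁆ = -(b • f 1 + c • f 2)
  e1f0 : ⁅e 1, f 0⁆ = 0
  e1f1 : ⁅e 1, f 1⁆ = 0
  e1f2 : ⁅e 1, f 2⁆ = a • f 0
  e1f3 : ⁅e 1, f 3⁆ = b • f 0 - d • f 2
  e2f0 : ⁅e 2, f 0⁆ = a' • e 1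
  e2f1 : ⁅e 2, f 1⁆ = -(a' • e 0)
  e2f2 : ⁅e 2, f 2⁆ = 0
  e2f3 : ⁅e 2, f 3⁆ = c • f 0 + d • f 1
  e3f0 : ⁅e 3, f 0⁆ = b' • e 1 + c' • e 2
  e3f1 : ⁅e 3, f 1⁆ = -(b' • e 0) + d' • e 2
  e3f2 : ⁅e 3, f 2⁆ = -(c' • e 0 + d' • e 1)
  e3f3 : ⁅e 3, f 3⁆ = 0

/-- With four indices, i, j < k leaves only the coefficients of e 2 and e 3 in [e 0, e 1], and of e
3 in [e 0, e 2] and [e 1, e 2]. -/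
theorem IsTriangularPair.exists_table (hB : IsInvariantScalarProduct B)
    (h : IsTriangularPair B e f) :
    ∃ a b c d a' b' c' d', IsTriangularPair.Table e f a b c d a' b' c' d' := by
  refine ⟨B ⁅e 0, e 1⁆ (f 2), B ⁅e 0, e 1⁆ (f 3), B ⁅e 0, e 2⁆ (f 3), B ⁅e 1, e 2⁆ (f 3),
    B ⁅f 0, f 1⁆ (e 2), B ⁅f 0, f 1⁆ (e 3), B ⁅f 0, f 2⁆ (e 3), B ⁅f 1, f 2⁆ (e 3), ?_⟩
  have ee : ∀ i j, ⁅e i, e j⁆ = _ := h.lie_e_e hB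
  have ff : ∀ i j, ⁅f i, f j⁆ = _ := (h.swap hB).lie_e_e hB
  have ef : ∀ i j, ⁅e i, f j⁆ = _ := h.lie_e_f hB
  simp only [Fin.sum_univ_four] at ee ff ef
  have c1 := h.lie_e_e_f
  have c2 := h.lie_f_f_e
  have c3 : B ⁅e 1, e 0⁆ = -B ⁅e 0, e 1⁆ := by rw [← lie_skew, map_neg]
  have c4 : B ⁅e 2, e 0⁆ = -B ⁅e 0, e 2⁆ := by rw [← lie_skew, map_neg]
  have c5 : B ⁅e 2, e 1⁆ = -B ⁅e 1, e 2⁆ := by rw [← lie_skew, map_neg]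
  have c6 : B ⁅f 1, f 0⁆ = -B ⁅f 0, f 1⁆ := by rw [← lie_skew, map_neg]
  have c7 : B ⁅f 2, f 0⁆ = -B ⁅f 0, f 2⁆ := by rw [← lie_skew, map_neg]
  have c8 : B ⁅f 2, f 1⁆ = -B ⁅f 1, f 2⁆ := by rw [← lie_skew, map_neg]
  constructor
  · conv_lhs => rw [ee]
    simp [c1]
  · conv_lhs => rw [ee]
    simp [c1]
  · conv_lhs => rw [ee]
    simp [c1]
  · intro i
    rw [ee]
    simp [c1, show ¬ (3 : Fin 4) < 2 by decide]
  · conv_lhs => rw [ff]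
    simp [c2]
  · conv_lhs => rw [ff]
    simp [c2]
  · conv_lhs => rw [ff]
    simp [c2]
  · intro i
    rw [ff]
    simp [c2, show ¬ (3 : Fin 4) < 2 by decide]
  all_goals
    rw [ef]
    simp [c1, c2, c3, c4, c5, c6, c7, c8]
  all_goals try module

/-- The quadratic relations between the structure constants forced by the Jacobi identity. -/
theorem IsTriangularPair.Table.relations (hB : IsInvariantScalarProduct B)
    (h : IsTriangularPair B e f) {a b c d a' b' c' d' : ℂ}
    (t : IsTriangularPair.Table e f a b c d a' b' c' d') :
    (a * a' = 0 ∧ b * b' = 0 ∧ c * c' = 0 ∧ d * d' = 0) ∧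
    (b * c' = 0 ∧ b * d' = 0 ∧ c * b' = 0 ∧ d * b' = 0 ∧ c * d' = 0 ∧ d * c' = 0) ∧
    a' * b = 0 ∧ a * b' = 0 := by
  have key : ∀ i j k l, B ⁅e i, e j⁆ ⁅f k, f l⁆ + B ⁅e j, f k⁆ ⁅e i, f l⁆
      - B ⁅e i, f k⁆ ⁅e j, f l⁆ = 0 := by
    intro i j k l
    have := hB.jacobi (e i) (e j) (f k) (f l)
    rwa [← lie_skew (f k) (e i), map_neg, LinearMap.neg_apply, ← sub_eq_add_neg] at this
  -- The instances with {i, j} = {k, l} give aa' + bb' = 0, cc' = aa' = dd' and cc' + dd' = 0 (among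
  -- others), so 2aa' = 0 and the four diagonal products vanish. Each remaining instance is a single
  -- monomial.
  have h1 := key 0 1 0 1
  have h2 := key 0 1 0 2
  have h3 := key 0 1 1 2
  have h4 := key 0 2 0 1
  have h5 := key 1 2 0 1
  have h6 := key 0 2 0 2
  have h7 := key 0 2 1 2
  have h8 := key 1 2 0 2
  have h9 := key 1 2 1 2
  have h10 := key 0 3 0 3
  have h11 := key 1 3 1 3
  have h12 := key 2 3 2 3
  have h13 := key 0 2 0 3
  have h14 := key 0 3 0 2
  simp [t.e01, t.e02, t.e12, t.ee3, t.f01, t.f02, t.f12, t.ff3, t.e0f0, t.e0f1, t.e0f2, t.e0f3,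
    t.e1f0, t.e1f1, t.e1f2, t.e1f3, t.e2f0, t.e2f1, t.e2f2, t.e2f3, t.e3f0, t.e3f1, t.e3f2,
    t.e3f3, h.apply_e_f, -mul_eq_zero]
    at h1 h2 h3 h4 h5 h6 h7 h8 h9 h10 h11 h12 h13 h14
  refine ⟨⟨?_, ?_, ?_, ?_⟩, ⟨?_, ?_, ?_, ?_, ?_, ?_⟩, ?_, ?_⟩ <;> grind

theorem IsTriangularPair.Table.swap {a b c d a' b' c' d' : ℂ}
    (t : IsTriangularPair.Table e f a b c d a' b' c' d') :
    IsTriangularPair.Table f e a' b' c' d' a b c d := by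
  constructor
  · exact t.f01
  · exact t.f02
  · exact t.f12
  · exact t.ff3
  · exact t.e01
  · exact t.e02
  · exact t.e12
  · exact t.ee3
  all_goals
    rw [← lie_skew]
    simp only [t.e0f0, t.e0f1, t.e0f2, t.e0f3, t.e1f0, t.e1f1, t.e1f2, t.e1f3, t.e2f0, t.e2f1,
      t.e2f2, t.e2f3, t.e3f0, t.e3f1, t.e3f2, t.e3f3]
  all_goals try module

theorem IsTriangularPair.Table.lie_e_e_eq_zero {a' b' c' d' : ℂ}
    (t : IsTriangularPair.Table e f 0 0 0 0 a' b' c' d') (i j : Fin 4) : ⁅e i, e j⁆ = 0 := by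
  have h01 : ⁅e 0, e 1⁆ = 0 := by rw [t.e01]; module
  have h02 : ⁅e 0, e 2⁆ = 0 := by rw [t.e02]; module
  have h12 : ⁅e 1, e 2⁆ = 0 := by rw [t.e12]; module
  have h10 : ⁅e 1, e 0⁆ = 0 := by rw [← lie_skew, h01, neg_zero]
  have h20 : ⁅e 2, e 0⁆ = 0 := by rw [← lie_skew, h02, neg_zero]
  have h21 : ⁅e 2, e 1⁆ = 0 := by rw [← lie_skew, h12, neg_zero]
  have h3 : ∀ i, ⁅e 3, e i⁆ = 0 := fun i => by rw [← lie_skew, t.ee3, neg_zero]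
  fin_cases i <;> fin_cases j <;> simp [h01, h02, h12, h10, h20, h21, h3, t.ee3]

/-- The case where the `f i` span an abelian ideal. -/
theorem IsTriangularPair.Table.classify_of_abelian [FiniteDimensional ℂ L]
    (hB : IsInvariantScalarProduct B) (h : IsTriangularPair B e f) {a b c d : ℂ}
    (t : IsTriangularPair.Table e f a b c d 0 0 0 0) :
    IsometricallyIsomorphic B (TrivialTStar.form ℂ (AbelianLie 4)) ∨
    IsometricallyIsomorphic B (TrivialTStar.form ℂ (HeisenbergLie × AbelianLie 1)) ∨
    IsometricallyIsomorphic B (TrivialTStar.form ℂ FiliformLie) := by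
  have hf := t.swap.lie_e_e_eq_zero
  have h10 : ⁅e 1, e 0⁆ = -(a • e 2 + b • e 3) := by rw [← lie_skew, t.e01]
  have h20 : ⁅e 2, e 0⁆ = -(c • e 3) := by rw [← lie_skew, t.e02]
  have h21 : ⁅e 2, e 1⁆ = -(d • e 3) := by rw [← lie_skew, t.e12]
  have h3 : ∀ i, ⁅e 3, e i⁆ = 0 := fun i => by rw [← lie_skew, t.ee3, neg_zero]
  by_cases hcd : c ≠ 0 ∨ d ≠ 0
  -- Bracketing with e 2 acts on the span of e 0, e 1 as the functional (c, d) times e 3. Thus p e 0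
  -- + q e 1 sends e 2 to e 3, and d e 0 - c e 1 commutes with e 2.
  · obtain ⟨p, q, hpq⟩ := exists_mul_add_mul_eq_one hcd
    by_cases ha : a = 0
    · subst ha
      -- The correction b e 2 makes the last vector of x commute with all the others, giving the
      -- abelian summand; y is the dual basis.
      refine Or.inr (Or.inl (IsHyperbolic.heisenbergProd hB
        (x := ![p • e 0 + q • e 1, e 2, e 3, d • e 0 - c • e 1 + b • e 2])
        (y := ![c • f 0 + d • f 1, -(b * q) • f 0 + (b * p) • f 1 + f 2, f 3,
          q • f 0 - p • f 1]) ⟨h.finrank_eq hB, ?_, ?_, ?_, ?_⟩ ?_ ?_ ?_ ?_ ?_ ?_))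
      · intro i j; fin_cases i <;> fin_cases j <;> simp [h.apply_e_e]
      · intro i j; fin_cases i <;> fin_cases j <;> simp [h.apply_f_f]
      · intro i j; fin_cases i <;> fin_cases j <;> simp [h.apply_e_f] <;> grind
      · intro i j; fin_cases i <;> fin_cases j <;> simp [hf]
      · simp only [Matrix.cons_val, add_lie, smul_lie, t.e02, t.e12, smul_smul, ← add_smul, hpq,
          one_smul]
      · simp [t.ee3]
      · simp [t.e01, t.e02, t.e12, h10]
        module
      · simp [t.ee3]
      · simp [h20, h21]
        module
      · simp [h3]
    -- Here [x 0, x 1] = (pc + qd)[e 0, e 1] = a e 2 + b e 3, and bracketing x 0 with this gives a e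
    -- 3; y is the dual basis, whence the inverses of a.
    · refine Or.inr (Or.inr (IsHyperbolic.filiform hB
        (x := ![p • e 0 + q • e 1, -d • e 0 + c • e 1, a • e 2 + b • e 3, a • e 3])
        (y := ![c • f 0 + d • f 1, -q • f 0 + p • f 1, a⁻¹ • f 2,
          a⁻¹ • f 3 - (a⁻¹ * a⁻¹ * b) • f 2]) ⟨h.finrank_eq hB, ?_, ?_, ?_, ?_⟩ ?_ ?_ ?_ ?_ ?_ ?_))
      · intro i j; fin_cases i <;> fin_cases j <;> simp [h.apply_e_e]
      · intro i j; fin_cases i <;> fin_cases j <;> simp [h.apply_f_f]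
      · intro i j; fin_cases i <;> fin_cases j <;> simp [h.apply_e_f, ha] <;> grind
      · intro i j; fin_cases i <;> fin_cases j <;> simp [hf]
      · simp [t.e01, h10]
        linear_combination (norm := module) hpq • (a • e 2 + b • e 3)
      · simp [t.ee3, t.e02, t.e12]
        linear_combination (norm := module) hpq • (a • e 3)
      · simp [t.ee3]
      · simp [t.ee3, t.e02, t.e12]
        module
      · simp [t.ee3]
      · simp [t.ee3]
  · push Not at hcd
    obtain ⟨rfl, rfl⟩ := hcd
    by_cases hab : a ≠ 0 ∨ b ≠ 0
    · obtain ⟨p, q, hpq⟩ := exists_mul_add_mul_eq_one hab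
      -- Only [e 0, e 1] = a e 2 + b e 3 survives. The last vector of x completes it to a basis of
      -- the span of e 2, e 3 with determinant ap + bq = 1.
      refine Or.inr (Or.inl (IsHyperbolic.heisenbergProd hB
        (x := ![e 0, e 1, a • e 2 + b • e 3, -q • e 2 + p • e 3])
        (y := ![f 0, f 1, p • f 2 + q • f 3, -b • f 2 + a • f 3])
        ⟨h.finrank_eq hB, ?_, ?_, ?_, ?_⟩ t.e01 ?_ ?_ ?_ ?_ ?_))
      · intro i j; fin_cases i <;> fin_cases j <;> simp [h.apply_e_e]
      · intro i j; fin_cases i <;> fin_cases j <;> simp [h.apply_f_f]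
      · intro i j; fin_cases i <;> fin_cases j <;> simp [h.apply_e_f] <;> grind
      · intro i j; fin_cases i <;> fin_cases j <;> simp [hf]
      · simp [t.ee3, t.e02]
      · simp [t.ee3, t.e02]
      · simp [t.ee3, t.e12]
      · simp [t.ee3, t.e12]
      · simp [t.ee3, h3]
    · push Not at hab
      obtain ⟨rfl, rfl⟩ := hab
      exact Or.inl ((h.isHyperbolic hB hf).abelian hB t.lie_e_e_eq_zero)

/-- The case where neither the `e i` nor the `f i` commute. -/
theorem IsTriangularPair.Table.filiform_of_mixed [FiniteDimensional ℂ L]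
    (hB : IsInvariantScalarProduct B) (h : IsTriangularPair B e f) {a c' d' : ℂ} (ha : a ≠ 0)
    (hcd : c' ≠ 0 ∨ d' ≠ 0) (t : IsTriangularPair.Table e f a 0 0 0 0 0 c' d') :
    IsometricallyIsomorphic B (TrivialTStar.form ℂ FiliformLie) := by
  obtain ⟨p, q, hpq⟩ := exists_mul_add_mul_eq_one hcd
  have s := t.swap
  have hfe := h.apply_f_e hB
  have h3 : ∀ i, ⁅e 3, e i⁆ = 0 := fun i => by rw [← lie_skew, t.ee3, neg_zero]
  have h3' : ∀ i, ⁅f 3, f i⁆ = 0 := fun i => by rw [← lie_skew, t.ff3, neg_zero]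
  have h20 : ⁅e 2, e 0⁆ = 0 := by rw [← lie_skew, t.e02]; module
  have h21 : ⁅e 2, e 1⁆ = 0 := by rw [← lie_skew, t.e12]; module
  have h20' : ⁅f 2, f 0⁆ = -(c' • f 3) := by rw [← lie_skew, t.f02]
  have h21' : ⁅f 2, f 1⁆ = -(d' • f 3) := by rw [← lie_skew, t.f12]
  -- The vectors f 2 and e 3 generate a filiform algebra: [f 2, e 3] = c' e 0 + d' e 1, and
  -- bracketing f 2 with that gives a(c' f 1 - d' f 0). It is Lagrangian, and y is a commuting dual
  -- basis built from e and f alike.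
  refine IsHyperbolic.filiform hB
    (x := ![f 2, e 3, c' • e 0 + d' • e 1, (a * c') • f 1 - (a * d') • f 0])
    (y := ![e 2, f 3, p • f 0 + q • f 1, (a⁻¹ * p) • e 1 - (a⁻¹ * q) • e 0])
    ⟨h.finrank_eq hB, ?_, ?_, ?_, ?_⟩ ?_ ?_ ?_ ?_ ?_ ?_
  · intro i j
    fin_cases i <;> fin_cases j <;> simp [h.apply_e_e, h.apply_f_f, h.apply_e_f, hfe] <;> ring
  · intro i j
    fin_cases i <;> fin_cases j <;> simp [h.apply_e_e, h.apply_f_f, h.apply_e_f, hfe] <;> ring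
  · intro i j
    fin_cases i <;> fin_cases j <;> simp [h.apply_e_e, h.apply_f_f, h.apply_e_f, hfe] <;> grind
  · intro i j
    fin_cases i <;> fin_cases j <;>
      simp [t.e02, t.e12, h20, h21, h3', t.ff3, t.e2f3, s.e3f2, t.e2f0, t.e2f1, s.e0f2, s.e1f2,
        t.e0f3, t.e1f3, s.e3f0, s.e3f1, t.e0f0, t.e0f1, t.e1f0, t.e1f1, s.e0f0, s.e0f1, s.e1f0,
        s.e1f1]
  · simp [s.e2f3]
  · simp [s.e2f0, s.e2f1]
    module
  · simp [h20', h21']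
    module
  · simp [h3]
  · simp [t.e3f0, t.e3f1]
    module
  · simp [t.e0f0, t.e0f1, t.e1f0, t.e1f1]

/-- When both sides are non-abelian, the relations force b = b' = 0. They then leave only a against
(c', d'), or a' against (c, d), and these two cases are exchanged by the swap. -/
theorem IsTriangularPair.classify_four [FiniteDimensional ℂ L]
    (hB : IsInvariantScalarProduct B) (h : IsTriangularPair B e f) :
    IsometricallyIsomorphic B (TrivialTStar.form ℂ (AbelianLie 4)) ∨
    IsometricallyIsomorphic B (TrivialTStar.form ℂ (HeisenbergLie × AbelianLie 1)) ∨
    IsometricallyIsomorphic B (TrivialTStar.form ℂ FiliformLie) := by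
  obtain ⟨a, b, c, d, a', b', c', d', t⟩ := h.exists_table hB
  have hrel := t.relations hB h
  simp only [mul_eq_zero] at hrel
  by_cases h' : a' = 0 ∧ b' = 0 ∧ c' = 0 ∧ d' = 0
  · obtain ⟨rfl, rfl, rfl, rfl⟩ := h'
    exact t.classify_of_abelian hB h
  by_cases h'' : a = 0 ∧ b = 0 ∧ c = 0 ∧ d = 0
  · obtain ⟨rfl, rfl, rfl, rfl⟩ := h''
    exact t.swap.classify_of_abelian hB (h.swap hB)
  right; right
  by_cases ha : a = 0
  · have hb : b = 0 := by grind
    have hb' : b' = 0 := by grind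
    have hc' : c' = 0 := by grind
    have hd' : d' = 0 := by grind
    subst ha hb hb' hc' hd'
    exact t.swap.filiform_of_mixed hB (h.swap hB) (by grind) (by grind)
  · have ha' : a' = 0 := by grind
    have hb : b = 0 := by grind
    have hb' : b' = 0 := by grind
    have hc : c = 0 := by grind
    have hd : d = 0 := by grind
    subst ha' hb hb' hc hd
    exact t.filiform_of_mixed hB h ha (by grind)

end DimensionEight

/-! ### The classification, by half the dimension -/

theorem mainTheorem2 {L : Type*} [LieRing L] [LieAlgebra ℂ L] [FiniteDimensional ℂ L]
    [Nontrivial L] (hdim : Module.finrank ℂ L ≤ 8)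
    (B : LinearMap.BilinForm ℂ L) (hB : IsInvariantScalarProduct B)
    (hω : ∃ ω : LinearMap.BilinForm ℂ L, IsSymplecticStructure ω) :
    IsometricallyIsomorphic B (TrivialTStar.form ℂ (AbelianLie 1)) ∨
    IsometricallyIsomorphic B (TrivialTStar.form ℂ (AbelianLie 2)) ∨
    IsometricallyIsomorphic B (TrivialTStar.form ℂ (AbelianLie 3)) ∨
    IsometricallyIsomorphic B (TrivialTStar.form ℂ (AbelianLie 4)) ∨
    IsometricallyIsomorphic B (TrivialTStar.form ℂ HeisenbergLie) ∨
    IsometricallyIsomorphic B (TrivialTStar.form ℂ (HeisenbergLie × AbelianLie 1)) ∨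
    IsometricallyIsomorphic B (TrivialTStar.form ℂ FiliformLie) := by
  obtain ⟨ω, hω⟩ := hω
  obtain ⟨n, e, f, h⟩ := hB.exists_triangularPair hω
  have hfin := h.finrank_eq hB
  have hpos : 0 < finrank ℂ L := finrank_pos
  have hn : n = 1 ∨ n = 2 ∨ n = 3 ∨ n = 4 := by omega
  rcases hn with rfl | rfl | rfl | rfl
  · exact Or.inl ((h.isHyperbolic hB
      ((h.swap hB).lie_e_e_eq_zero_of_le_two hB (by omega))).abelian hB
      (h.lie_e_e_eq_zero_of_le_two hB (by omega)))
  · exact Or.inr (Or.inl ((h.isHyperbolic hB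
      ((h.swap hB).lie_e_e_eq_zero_of_le_two hB le_rfl)).abelian hB
      (h.lie_e_e_eq_zero_of_le_two hB le_rfl)))
  · by_cases he : B ⁅e 0, e 1⁆ (f 2) = 0
    · by_cases hf : B ⁅f 0, f 1⁆ (e 2) = 0
      · exact Or.inr (Or.inr (Or.inl ((h.isHyperbolic hB
          ((h.swap hB).lie_eq_zero_three hB hf)).abelian hB (h.lie_eq_zero_three hB he))))
      · have := (h.swap hB).heisenberg_of_ne_zero hB hf
        tauto
    · have := h.heisenberg_of_ne_zero hB he
      tauto
  · have := h.classify_four hB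
    tauto
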